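/- Let $X$ and $Y$ be real Hilbert spaces, $X$ separable, let $W:X\to Y$ be a bounded linear operator with adjoint $W^*$, and let $\sigma>0$. (In photoacoustic tomography $X=L^2(\Omega)$, $Y=L^2(0,T;L^2(\Sigma))$, and $W=\mathcal W_i$ is the forward operator belonging to the intensity function $i$; nothing but its linearity and boundedness is used.) Let $\Gamma_{\rm pr}:X\to X$ be a bounded self-adjoint positive definite operator of trace class, so that $\Gamma_{\rm pr}^{-1}$ is a densely defined, in general unbounded, operator with domain $\operatorname{ran}\Gamma_{\rm pr}$. A positive operator $A$ is of trace class if it is compact and $\operatorname{tr}A=\sum_k\langle Ae_k,e_k\rangle<\infty$ for orthonormal bases $(e_k)$. Consider the inverse problem $p=Wa+\eta$ with noise $\eta\sim\mathcal N(0,\sigma^2 I)$ (white noise if $Y$ is infinite-dimensional) and prior $a\sim\mu_{\rm pr}=\mathcal N(a_0,\Gamma_{\rm pr})$, $a_0\in X$. For $p_{\rm obs}\in Y$ the posterior distribution is the probability measure given by Bayes' formula $$\frac{d\mu_{\rm post}}{d\mu_{\rm pr}}(a)\ \propto\ \exp\Big(-\tfrac1{2\sigma^2}\|Wa-p_{\rm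 obs}\|_Y^2\Big),$$ and a MAP estimate is a minimizer over $a\in X$ of $$J(a)=\tfrac1{2\sigma^2}\|Wa-p_{\rm obs}\|_Y^2+\tfrac12\big\|\Gamma_{\rm pr}^{-1/2}(a-a_0)\big\|_X^2,$$ where $J(a)=+\infty$ if $a-a_0\notin\operatorname{ran}\Gamma_{\rm pr}^{1/2}$. Then the following hold. 1. The operator $\sigma^{-2}W^*W+\Gamma_{\rm pr}^{-1}$ with domain $\operatorname{ran}\Gamma_{\rm pr}$ is a bijection onto $X$ with bounded inverse $$\Gamma_{\rm post}=\big(\sigma^{-2}W^*W+\Gamma_{\rm pr}^{-1}\big)^{-1}:X\to X .$$ 2. $\Gamma_{\rm post}$ is self-adjoint, positive definite and of trace class, and $\operatorname{tr}\Gamma_{\rm post}\le\operatorname{tr}\Gamma_{\rm pr}$. 3. The operator $\Gamma_{\rm post}\Gamma_{\rm pr}^{-1}$, defined on $\operatorname{ran}\Gamma_{\rm pr}$, extends to a bounded operator on $X$. For all $a_0\in X$ and $p_{\rm obs}\in Y$ there is exactly one MAP estimate, namely $$a_{\rm MAP}=\Gamma_{\rm post}\big(\sigma^{-2}W^*p_{\rm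 obs}+\Gamma_{\rm pr}^{-1}a_0\big),$$ where, if $a_0\notin\operatorname{ran}\Gamma_{\rm pr}$, the term $\Gamma_{\rm post}\Gamma_{\rm pr}^{-1}a_0$ is understood through this bounded extension. 4. For all $a_0\in X$ and $p_{\rm obs}\in Y$ the posterior distribution is the Gaussian measure $\mathcal N(a_{\rm MAP},\Gamma_{\rm post})$; in particular its covariance operator is $\Gamma_{\rm post}$ and its mean is $a_{\rm MAP}$. -/

import Mathlib

open MeasureTheory ProbabilityTheory InnerProductSpace
open scoped RealInnerProductSpace InnerProduct

noncomputable section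

namespace BayesInverse

variable {X Y : Type*}
  [NormedAddCommGroup X] [InnerProductSpace ℝ X]
  [NormedAddCommGroup Y] [InnerProductSpace ℝ Y]

/-- A bounded operator that is self-adjoint and positive definite: `⟪C x, x⟫ > 0` for `x ≠ 0`. -/
def IsPositiveDefinite (C : X →L[ℝ] X) : Prop :=
  C.IsPositive ∧ ∀ x : X, x ≠ 0 → 0 < ⟪C x, x⟫

/-- The trace `∑ₖ ⟪A eₖ, eₖ⟫` computed along an orthonormal (Hilbert) basis `e`. -/
def traceAlong {ι : Type*} (e : HilbertBasis ι ℝ X) (A : X →L[ℝ] X) : ℝ :=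
  ∑' k, ⟪A (e k), e k⟫

/-- Trace-class operators (the notion is only used for positive operators): `A` is compact and
`∑ₖ ⟪A eₖ, eₖ⟫` converges along every orthonormal basis `e`. Bases are indexed by subsets of `X`,
which loses nothing because an orthonormal basis is an injective family. -/
def IsTraceClass (A : X →L[ℝ] X) : Prop :=
  IsCompactOperator A ∧
    ∀ (s : Set X) (e : HilbertBasis s ℝ X), Summable fun k => ⟪A (e k), e k⟫

/-- The (in general unbounded) inverse `C⁻¹` of an injective bounded operator `C`,
with domain the range of `C`. -/
def opInv (C : X →L[ℝ] X) : X →ₗ.[ℝ] X :=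
  ((C : X →ₗ[ℝ] X).toPMap ⊤).inverse

open Classical in
/-- The positive square root `C^{1/2}` of a positive operator `C`: the unique positive `S` with
`S ∘ S = C`. -/
def posSqrt (C : X →L[ℝ] X) : X →L[ℝ] X :=
  if h : ∃ S : X →L[ℝ] X, S.IsPositive ∧ S ∘L S = C then h.choose else 0

/-- `μ = N(m, C)`: `μ` is a Gaussian measure on `X` with mean `m` and covariance operator `C`,
that is, `cov_μ(⟪x, ·⟫, ⟪y, ·⟫) = ⟪C x, y⟫`. -/
def IsGaussianWith [MeasurableSpace X] [BorelSpace X]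
    (μ : Measure X) (m : X) (C : X →L[ℝ] X) : Prop :=
  IsGaussian μ ∧ ∫ a, a ∂μ = m ∧ ∀ x y : X, covarianceBilin μ x y = ⟪C x, y⟫

/-- The negative log-likelihood `½ ⟪Γₙ⁻¹ (W a - p), W a - p⟫` of the datum `p` given the
parameter `a` in the model `p = W a + η`, `η ∼ N(0, Γₙ)`, where the noise covariance `Γₙ` is
boundedly invertible. -/
def negLogLikelihood (Γn : Y →L[ℝ] Y) (W : X →L[ℝ] Y) (p : Y) (a : X) : ℝ :=
  1 / 2 * ⟪(Ring.inverse Γn) (W a - p), W a - p⟫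

/-- The posterior distribution of `a` given `p` (Bayes' formula): the probability measure
proportional to `exp (-negLogLikelihood) · μpr`. -/
def posterior [MeasurableSpace X] (Γn : Y →L[ℝ] Y) (W : X →L[ℝ] Y) (p : Y) (μpr : Measure X) :
    Measure X :=
  μpr.tilted fun a => -negLogLikelihood Γn W p a

open Classical in
/-- The Tikhonov (Onsager-Machlup) functional
`J(a) = ½ ⟪Γₙ⁻¹ (W a - p), W a - p⟫ + ½ ‖Γ^{-1/2} (a - a₀)‖²`,
equal to `+∞` when `a - a₀` is outside the domain of `Γ^{-1/2}`. -/
def tikhonov (Γn : Y →L[ℝ] Y) (W : X →L[ℝ] Y) (p : Y) (a₀ : X) (Γ : X →L[ℝ] X) (a : X) : EReal :=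
  if h : a - a₀ ∈ (opInv (posSqrt Γ)).domain then
    ((negLogLikelihood Γn W p a + 1 / 2 * ‖opInv (posSqrt Γ) ⟨a - a₀, h⟩‖ ^ 2 : ℝ) : EReal)
  else ⊤

/-- `a` is a maximum a posteriori (MAP) estimate: a global minimizer of `J` over `X`. -/
def IsMAP (Γn : Y →L[ℝ] Y) (W : X →L[ℝ] Y) (p : Y) (a₀ : X) (Γ : X →L[ℝ] X) (a : X) : Prop :=
  ∀ b : X, tikhonov Γn W p a₀ Γ a ≤ tikhonov Γn W p a₀ Γ b

end BayesInverse

end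

noncomputable section

namespace BayesInverse

variable {X Y : Type*}
  [NormedAddCommGroup X] [InnerProductSpace ℝ X]
  [NormedAddCommGroup Y] [InnerProductSpace ℝ Y]

/-! ### Spectral construction of the square root of a compact positive operator -/

section Diagonal

variable {ι : Type*}

/-! Write `C = S²` for the prior covariance and `B = σ⁻² W* W ≥ 0`. Formally `(B + C⁻¹)⁻¹ = S (1 + S
B S)⁻¹ S`, and the right side makes sense because `1 + S B S ≥ 1` is boundedly invertible. The
operator `G` so defined (`exists_update`) satisfies `G + C B G = C` and `G + G B C = C`. These two
bounded identities replace all calculus with `C⁻¹`: they give the inverse, positivity, `G ≤ C`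
(hence the trace bound) and the extension `1 - G B` of `G C⁻¹`.

The MAP estimate comes from completing the square around the solution of `a = a₀ + C (b - B a)`,
where `b = σ⁻² W* p`. The posterior is identified by its Laplace transform: Cameron–Martin with
shift `G z` evaluates it explicitly (`IsGaussianWith.tilted_quadratic`), and a Laplace transform of
Gaussian form forces the measure to be Gaussian. -/

lemma memlp_two_mul {m : ι → ℝ} {M : ℝ} (hm : ∀ i, |m i| ≤ M) (f : lp (fun _ : ι => ℝ) 2) :
    Memℓp (fun i => m i * f i) 2 := by
  have hf := (memℓp_gen_iff (by norm_num : 0 < (2 : ENNReal).toReal)).1 (lp.memℓp f)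
  refine (memℓp_gen_iff (by norm_num : 0 < (2 : ENNReal).toReal)).2 ?_
  simp only [ENNReal.toReal_ofNat, Real.rpow_ofNat, norm_mul, mul_pow] at hf ⊢
  refine Summable.of_nonneg_of_le (fun i => by positivity) (fun i => ?_) (hf.mul_left (M ^ 2))
  have h : ‖m i‖ ^ 2 ≤ M ^ 2 := by
    rw [Real.norm_eq_abs]
    exact pow_le_pow_left₀ (abs_nonneg _) (hm i) 2
  gcongr

/-- Multiplication of `ℓ²` sequences by a bounded sequence. -/
def diagL2 (m : ι → ℝ) (M : ℝ) (hm : ∀ i, |m i| ≤ M) :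
    lp (fun _ : ι => ℝ) 2 →L[ℝ] lp (fun _ : ι => ℝ) 2 :=
  LinearMap.mkContinuous
    { toFun := fun f => ⟨fun i => m i * f i, memlp_two_mul hm f⟩
      map_add' := fun f g => by ext i; exact mul_add _ _ _
      map_smul' := fun c f => by ext i; exact mul_left_comm _ _ _ } |M| <| by
    intro f
    refine le_of_sq_le_sq ?_ (by positivity)
    rw [mul_pow]
    have hf := lp.hasSum_norm (by norm_num : 0 < (2 : ENNReal).toReal) f
    have hg := lp.hasSum_norm (by norm_num : 0 < (2 : ENNReal).toReal)
      (⟨fun i => m i * f i, memlp_two_mul hm f⟩ : lp (fun _ : ι => ℝ) 2)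
    simp only [ENNReal.toReal_ofNat, Real.rpow_ofNat, norm_mul, mul_pow] at hf hg
    refine hasSum_le (fun i => ?_) hg (hf.mul_left (|M| ^ 2))
    have h : ‖m i‖ ^ 2 ≤ |M| ^ 2 := by
      rw [Real.norm_eq_abs]
      exact pow_le_pow_left₀ (abs_nonneg _) ((hm i).trans (le_abs_self M)) 2
    gcongr

@[simp]
lemma diagL2_apply (m : ι → ℝ) (M : ℝ) (hm : ∀ i, |m i| ≤ M) (f : lp (fun _ : ι => ℝ) 2) (i : ι) :
    diagL2 m M hm f i = m i * f i := rfl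

/-- A compact self-adjoint operator has an orthonormal basis of eigenvectors. -/
lemma exists_hilbertBasis_eigenvectors.{u} {X : Type u} [NormedAddCommGroup X]
    [InnerProductSpace ℝ X] [CompleteSpace X] {C : X →L[ℝ] X}
    (hC : IsCompactOperator C) (hsym : C.IsSymmetric) :
    ∃ (ι : Type u) (b : HilbertBasis ι ℝ X) (l : ι → ℝ), ∀ i, C (b i) = l i • b i := by
  have hcl : ∀ μ : ℝ, CompleteSpace (Module.End.eigenspace (C : X →ₗ[ℝ] X) μ) := fun μ => by
    have : IsClosed (Module.End.eigenspace (C : X →ₗ[ℝ] X) μ : Set X) := by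
      have : (Module.End.eigenspace (C : X →ₗ[ℝ] X) μ : Set X) = {x | C x = μ • x} := by
        ext x; simp
      rw [this]
      exact isClosed_eq C.continuous (continuous_const_smul μ)
    exact this.completeSpace_coe
  choose w b hb using fun μ : ℝ =>
    exists_hilbertBasis ℝ (Module.End.eigenspace (C : X →ₗ[ℝ] X) μ)
  let v : (Σ μ : ℝ, w μ) → X := fun a => (b a.1 a.2 : X)
  have hv : Orthonormal ℝ v :=
    hsym.orthogonalFamily_eigenspaces.orthonormal_sigma_orthonormal (fun μ => (b μ).orthonormal)
  -- A vector orthogonal to the basis of each eigenspace is orthogonal to the eigenspace by density,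
  -- hence zero by the spectral theorem.
  have hsp : (Submodule.span ℝ (Set.range v))ᗮ = ⊥ := by
    rw [eq_bot_iff, ← C.orthogonalComplement_iSup_eigenspaces_eq_bot hC hsym]
    intro x hx
    rw [← Submodule.iInf_orthogonal, Submodule.mem_iInf]
    intro μ u hu
    have h0 : (innerSL ℝ x).comp (Module.End.eigenspace (C : X →ₗ[ℝ] X) μ).subtypeL = 0 := by
      refine ContinuousLinearMap.ext_on
        (Submodule.dense_iff_topologicalClosure_eq_top.2 (b μ).dense_span) ?_
      rintro _ ⟨i, rfl⟩
      have := hx (v ⟨μ, i⟩) (Submodule.subset_span ⟨_, rfl⟩)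
      rw [real_inner_comm] at this
      simpa [v] using this
    have := DFunLike.congr_fun h0 ⟨u, hu⟩
    rw [real_inner_comm]
    simpa using this
  refine ⟨_, HilbertBasis.mkOfOrthogonalEqBot hv hsp, fun a => a.1, fun a => ?_⟩
  rw [HilbertBasis.coe_mkOfOrthogonalEqBot]
  exact Module.End.mem_eigenspace_iff.1 (b a.1 a.2).2

/-- A compact positive operator has a positive square root. -/
lemma exists_posSqrt [CompleteSpace X] {C : X →L[ℝ] X} (hC : IsCompactOperator C)
    (hpos : C.IsPositive) : ∃ S : X →L[ℝ] X, S.IsPositive ∧ S ∘L S = C := by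
  obtain ⟨ι, b, l, hl⟩ := exists_hilbertBasis_eigenvectors hC hpos.isSymmetric
  have hbn : ∀ i, ‖b i‖ = 1 := b.orthonormal.1
  have hl0 : ∀ i, l i = ⟪C (b i), b i⟫ := fun i => by
    rw [hl, real_inner_smul_left, real_inner_self_eq_norm_sq, hbn]; simp
  have hlnn : ∀ i, 0 ≤ l i := fun i => hl0 i ▸ hpos.inner_nonneg_left _
  have hlM : ∀ i, l i ≤ ‖C‖ := fun i => by
    rw [hl0]
    calc _ ≤ ‖C (b i)‖ * ‖b i‖ := real_inner_le_norm _ _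
      _ ≤ ‖C‖ * ‖b i‖ * ‖b i‖ := by gcongr; exact C.le_opNorm _
      _ = ‖C‖ := by simp [hbn]
  have hm : ∀ i, |√(l i)| ≤ √‖C‖ := fun i => by
    rw [abs_of_nonneg (Real.sqrt_nonneg _)]; exact Real.sqrt_le_sqrt (hlM i)
  let D := diagL2 (fun i => √(l i)) _ hm
  let S : X →L[ℝ] X :=
    (b.repr.symm.toContinuousLinearEquiv : _ →L[ℝ] X) ∘L D ∘L
      (b.repr.toContinuousLinearEquiv : X →L[ℝ] _)
  have hS : ∀ x, b.repr (S x) = D (b.repr x) := fun x => by simp [S]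
  refine ⟨S, (ContinuousLinearMap.isPositive_iff _).2 ⟨fun x y => ?_, fun x => ?_⟩, ?_⟩
  · change ⟪S x, y⟫ = ⟪x, S y⟫
    rw [← b.repr.inner_map_map, ← b.repr.inner_map_map, hS, hS, lp.inner_eq_tsum, lp.inner_eq_tsum]
    refine tsum_congr fun i => ?_
    simp [D]; ring
  · rw [← b.repr.inner_map_map, hS, lp.inner_eq_tsum]
    refine tsum_nonneg fun i => ?_
    simp only [D, diagL2_apply, RCLike.inner_apply, conj_trivial]
    have := Real.sqrt_nonneg (l i)
    nlinarith [mul_nonneg this (mul_self_nonneg (b.repr x i))]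
  · ext x
    apply b.repr.injective
    ext i
    rw [ContinuousLinearMap.comp_apply, hS, hS]
    simp only [D, diagL2_apply]
    rw [← mul_assoc, Real.mul_self_sqrt (hlnn i), b.repr_apply_apply, b.repr_apply_apply,
      ← hpos.inner_left_eq_inner_right, hl, real_inner_smul_left]

lemma posSqrt_spec {C : X →L[ℝ] X} (h : ∃ S : X →L[ℝ] X, S.IsPositive ∧ S ∘L S = C) :
    (posSqrt C).IsPositive ∧ posSqrt C ∘L posSqrt C = C := by
  rw [posSqrt, dif_pos h]
  exact h.choose_spec

end Diagonal

/-! ### The bounded form of the posterior covariance -/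

section Update

/-- The operator `(B + C⁻¹)⁻¹` for positive `B` and `C = S²`, in a form that needs no inverse
of `C`. -/
lemma exists_update [CompleteSpace X] {B C S : X →L[ℝ] X} (hB : B.IsPositive) (hS : S.IsPositive)
    (hSC : S ∘L S = C) :
    ∃ G : X →L[ℝ] X, G.IsSymmetric ∧ (∀ x, G x + C (B (G x)) = C x) ∧
      ∀ x, G x + G (B (C x)) = C x := by
  -- `⟪A x, x⟫ ≥ ‖x‖²` makes `A` invertible; the witness is `S A⁻¹ S`.
  set A : X →L[ℝ] X := 1 + S ∘L B ∘L S with hA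
  have hAx : ∀ x, A x = x + S (B (S x)) := fun x => rfl
  have hAsym : ∀ x y, ⟪A x, y⟫ = ⟪x, A y⟫ := fun x y => by
    rw [hAx, hAx, inner_add_left, inner_add_right, hS.inner_left_eq_inner_right,
      hB.inner_left_eq_inner_right, hS.inner_left_eq_inner_right]
  have hu : IsUnit A := by
    refine ContinuousLinearMap.isUnit_of_forall_le_norm_inner_map A (c := 1) one_pos fun x => ?_
    rw [hAx, inner_add_left, hS.inner_left_eq_inner_right, real_inner_self_eq_norm_sq]
    have := hB.inner_nonneg_left (S x)
    rw [Real.norm_of_nonneg (by positivity)]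
    simpa using this
  obtain ⟨u, hu⟩ := hu
  set P : X →L[ℝ] X := ↑u⁻¹ with hP
  have hAP : ∀ x, A (P x) = x := fun x => by
    have := u.mul_inv
    rw [hu] at this
    exact DFunLike.congr_fun this x
  have hPA : ∀ x, P (A x) = x := fun x => by
    have := u.inv_mul
    rw [hu] at this
    exact DFunLike.congr_fun this x
  have hC : ∀ x, C x = S (S x) := fun x => by rw [← hSC]; rfl
  refine ⟨S ∘L P ∘L S, fun x y => ?_, fun x => ?_, fun x => ?_⟩
  · change ⟪S (P (S x)), y⟫ = ⟪x, S (P (S y))⟫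
    rw [hS.inner_left_eq_inner_right, ← hS.inner_left_eq_inner_right x]
    conv_lhs => rw [← hAP (S y)]
    rw [← hAsym, hAP]
  · simp only [ContinuousLinearMap.comp_apply, hC]
    rw [← map_add, ← hAx, hAP]
  · simp only [ContinuousLinearMap.comp_apply, hC]
    rw [← map_add, ← map_add, ← hAx, hPA]

variable {B C G : X →L[ℝ] X}

/-- With `y = G x` this is the form `⟪C⁻¹ y + B y, y⟫`, where `x - B y` plays the role of `C⁻¹ y`.
-/
lemma inner_update_self (hG : ∀ x, G x + C (B (G x)) = C x)
    (x : X) : ⟪G x, x⟫ = ⟪C (x - B (G x)), x - B (G x)⟫ + ⟪B (G x), G x⟫ := by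
  have h : C (x - B (G x)) = G x := by rw [map_sub, ← hG x]; abel
  rw [h, inner_sub_right, real_inner_comm (G x) (B (G x))]
  ring

lemma isPositiveDefinite_update (hB : B.IsPositive) (hC : IsPositiveDefinite C)
    (hsym : G.IsSymmetric) (hG : ∀ x, G x + C (B (G x)) = C x) : IsPositiveDefinite G := by
  have key := inner_update_self hG
  refine ⟨(ContinuousLinearMap.isPositive_iff _).2 ⟨hsym, fun x => ?_⟩, fun x hx => ?_⟩
  · rw [key]
    exact add_nonneg (hC.1.inner_nonneg_left _) (hB.inner_nonneg_left _)
  · rw [key]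
    refine add_pos_of_pos_of_nonneg (hC.2 _ fun h => hx ?_) (hB.inner_nonneg_left _)
    have h0 : G x = 0 := by
      have h' : C (x - B (G x)) = G x := by rw [map_sub, ← hG x]; abel
      rw [← h', h, map_zero]
    simpa [h0] using h

lemma inner_update_le (hB : B.IsPositive) (hC : C.IsPositive)
    (hG : ∀ x, G x + C (B (G x)) = C x) (x : X) : ⟪G x, x⟫ ≤ ⟪C x, x⟫ := by
  -- The identity for `C x` is used twice: once directly, once after moving `C` across in `⟪C (B (G
  -- x)), x⟫`. Both extra terms are nonnegative.
  have h : ⟪C x, x⟫ = ⟪G x, x⟫ + (⟪B (G x), G x⟫ + ⟪B (G x), C (B (G x))⟫) := by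
    rw [← inner_add_right, hG x, ← hC.inner_left_eq_inner_right, ← inner_add_left, hG x]
  rw [h]
  have h1 := hB.inner_nonneg_left (G x)
  have h2 := hC.inner_nonneg_right (B (G x))
  linarith

/-- Compactness passes through `G = C (1 - B G)`, summability through `G ≤ C`. -/
lemma isTraceClass_update (hB : B.IsPositive) (hC : C.IsPositive) (hCtr : IsTraceClass C)
    (hGpos : G.IsPositive) (hG : ∀ x, G x + C (B (G x)) = C x) : IsTraceClass G := by
  refine ⟨?_, fun s e => ?_⟩
  · have : G = C ∘L (1 - B ∘L G) := by
      ext x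
      change G x = C (x - B (G x))
      rw [map_sub, ← hG x]; abel
    rw [this]
    exact hCtr.1.comp_clm _
  · exact Summable.of_nonneg_of_le (fun k => hGpos.inner_nonneg_left _)
      (fun k => inner_update_le hB hC hG _) (hCtr.2 s e)

lemma traceAlong_update_le (hB : B.IsPositive) (hC : C.IsPositive) (hCtr : IsTraceClass C)
    (hGpos : G.IsPositive) (hG : ∀ x, G x + C (B (G x)) = C x)
    (s : Set X) (e : HilbertBasis s ℝ X) : traceAlong e G ≤ traceAlong e C :=
  Summable.tsum_le_tsum (fun _ => inner_update_le hB hC hG _)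
    ((isTraceClass_update hB hC hCtr hGpos hG).2 s e) (hCtr.2 s e)

end Update

/-! ### The unbounded operator `B + C⁻¹` and its inverse -/

section OpInv

variable {C : X →L[ℝ] X}

lemma IsPositiveDefinite.injective (hC : IsPositiveDefinite C) : Function.Injective C := by
  refine (injective_iff_map_eq_zero C).2 fun x hx => ?_
  by_contra h
  simpa [hx] using hC.2 x h

lemma ker_toPMap_top_eq_bot (hC : Function.Injective C) :
    ((C : X →ₗ[ℝ] X).toPMap ⊤).toFun.ker = ⊥ := by
  refine LinearMap.ker_eq_bot'.2 fun x hx => Subtype.ext (hC ?_)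
  exact Eq.trans hx (map_zero C).symm

lemma mem_opInv_domain {y : X} : y ∈ (opInv C).domain ↔ ∃ x, C x = y := by
  rw [opInv, LinearPMap.inverse_domain, LinearMap.mem_range]
  exact ⟨fun ⟨x, hx⟩ => ⟨x, hx⟩, fun ⟨x, hx⟩ => ⟨⟨x, trivial⟩, hx⟩⟩

lemma opInv_apply (hC : Function.Injective C) (x : X) (h : C x ∈ (opInv C).domain) :
    opInv C ⟨C x, h⟩ = x :=
  LinearPMap.inverse_apply_eq (f := (C : X →ₗ[ℝ] X).toPMap ⊤) (ker_toPMap_top_eq_bot hC)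
    (y := ⟨C x, h⟩) (x := ⟨x, trivial⟩) rfl

variable {B G : X →L[ℝ] X}

lemma mem_add_opInv_domain {y : X} :
    y ∈ ((B : X →ₗ[ℝ] X).toPMap ⊤ + opInv C).domain ↔ ∃ x, C x = y := by
  rw [← mem_opInv_domain, LinearPMap.add_domain]
  simp

lemma add_opInv_apply (hC : Function.Injective C) (x : X)
    (h : C x ∈ ((B : X →ₗ[ℝ] X).toPMap ⊤ + opInv C).domain) :
    ((B : X →ₗ[ℝ] X).toPMap ⊤ + opInv C) ⟨C x, h⟩ = B (C x) + x := by
  rw [LinearPMap.add_apply]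
  congr 1
  exact opInv_apply hC x _

lemma add_opInv_injective (hC : Function.Injective C) (hG : ∀ x, G x + G (B (C x)) = C x) :
    Function.Injective ((B : X →ₗ[ℝ] X).toPMap ⊤ + opInv C) := by
  rintro ⟨y, hy⟩ ⟨y', hy'⟩ h
  obtain ⟨x, rfl⟩ := mem_add_opInv_domain.1 hy
  obtain ⟨x', rfl⟩ := mem_add_opInv_domain.1 hy'
  rw [add_opInv_apply hC, add_opInv_apply hC] at h
  have := congrArg G h
  rw [map_add, map_add, add_comm, hG, add_comm, hG] at this
  exact Subtype.ext this

/-- `G x = C u` with `u = x - B (G x)`, so `B + C⁻¹` sends `G x` to `B (G x) + u = x`. This also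
shows surjectivity. -/
lemma inverse_add_opInv (hC : Function.Injective C) (hG : ∀ x, G x + C (B (G x)) = C x)
    (hG' : ∀ x, G x + G (B (C x)) = C x) :
    ((B : X →ₗ[ℝ] X).toPMap ⊤ + opInv C).inverse = (G : X →ₗ[ℝ] X).toPMap ⊤ := by
  have hker : ((B : X →ₗ[ℝ] X).toPMap ⊤ + opInv C).toFun.ker = ⊥ :=
    LinearMap.ker_eq_bot.2 (add_opInv_injective hC hG')
  have hCG : ∀ x, C (x - B (G x)) = G x := fun x => by rw [map_sub, ← hG x]; abel
  have hmem : ∀ x, G x ∈ ((B : X →ₗ[ℝ] X).toPMap ⊤ + opInv C).domain := fun x =>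
    mem_add_opInv_domain.2 ⟨_, hCG x⟩
  have hval : ∀ x, ((B : X →ₗ[ℝ] X).toPMap ⊤ + opInv C) ⟨G x, hmem x⟩ = x := fun x => by
    have h := add_opInv_apply (B := B) hC (x - B (G x)) (by rw [hCG]; exact hmem x)
    simp only [hCG] at h
    rw [h]; abel
  refine LinearPMap.ext ?_ fun x hx _ => ?_
  · rw [LinearPMap.inverse_domain, LinearMap.toPMap_domain, LinearMap.range_eq_top]
    exact fun x => ⟨⟨G x, hmem x⟩, hval x⟩
  · exact LinearPMap.inverse_apply_eq hker (y := ⟨x, hx⟩) (x := ⟨G x, hmem x⟩) (hval x)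

end OpInv

/-! ### Laplace transforms and tilting of Gaussian measures -/

section Gaussian

/-- The Gaussian moment generating function is finite on all of `ℝ`, so equality extends
analytically to the complex plane, where the transform determines the measure. -/
lemma eq_gaussianReal_of_mgf {μ : Measure ℝ} [IsProbabilityMeasure μ] {m : ℝ} {v : NNReal}
    (h : ∀ t, mgf id μ t = Real.exp (m * t + v * t ^ 2 / 2)) : μ = gaussianReal m v := by
  have hmgf : mgf id (gaussianReal m v) = mgf id μ := by
    rw [mgf_id_gaussianReal]
    exact funext fun t => (h t).symm
  refine Measure.ext_of_complexMGF_id_eq (funext fun z => ?_)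
  refine (eqOn_complexMGF_of_mgf hmgf ?_).symm
  simp

variable [CompleteSpace X] [SecondCountableTopology X] [MeasurableSpace X] [BorelSpace X]

lemma IsGaussianWith.map_inner {μ : Measure X} {m : X} {C : X →L[ℝ] X}
    (h : IsGaussianWith μ m C) (z : X) :
    μ.map (fun a => ⟪z, a⟫) = gaussianReal ⟪z, m⟫ ⟪C z, z⟫.toNNReal := by
  obtain ⟨hg, hm, hcov⟩ := h
  have h1 := IsGaussian.map_eq_gaussianReal (μ := μ) (innerSL ℝ z)
  have h2 : MemLp id 2 μ := IsGaussian.memLp_two_id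
  simp only [innerSL_apply_apply] at h1
  have h3 : Var[fun a => ⟪z, a⟫; μ] = ⟪C z, z⟫ := by
    rw [← covarianceBilin_self h2, hcov]
  have h4 : ∫ a, ⟪z, a⟫ ∂μ = ⟪z, m⟫ := by
    rw [← hm]
    exact integral_inner (h2.integrable (by norm_num)) z
  rw [h4] at h1
  rw [← h3]
  exact h1

lemma IsGaussianWith.integral_exp {μ : Measure X} {m : X} {C : X →L[ℝ] X}
    (h : IsGaussianWith μ m C) (hC : C.IsPositive) (z : X) :
    ∫ a, Real.exp ⟪z, a⟫ ∂μ = Real.exp (⟪z, m⟫ + ⟪C z, z⟫ / 2) := by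
  have := mgf_gaussianReal (h.map_inner z) 1
  simpa [mgf, Real.coe_toNNReal _ (hC.inner_nonneg_left z)] using this

lemma IsGaussianWith.integrable_exp {μ : Measure X} {m : X} {C : X →L[ℝ] X}
    (h : IsGaussianWith μ m C) (hC : C.IsPositive) (z : X) :
    Integrable (fun a => Real.exp ⟪z, a⟫) μ := by
  -- A non-integrable function has integral `0` by convention, whereas the formula gives a positive
  -- value.
  by_contra hn
  have := h.integral_exp hC z
  rw [integral_undef hn] at this
  exact (Real.exp_pos _).ne this

/-- A probability measure with Gaussian Laplace transform is Gaussian. -/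
lemma isGaussianWith_of_integral_exp {ν : Measure X} [IsProbabilityMeasure ν] {m : X}
    {C : X →L[ℝ] X} (hC : C.IsPositive)
    (h : ∀ z, ∫ a, Real.exp ⟪z, a⟫ ∂ν = Real.exp (⟪z, m⟫ + ⟪C z, z⟫ / 2)) :
    IsGaussianWith ν m C := by
  have hmap : ∀ z : X, ν.map (fun a => ⟪z, a⟫) = gaussianReal ⟪z, m⟫ ⟪C z, z⟫.toNNReal := by
    intro z
    have hmeas : AEMeasurable (fun a : X => ⟪z, a⟫) ν := by fun_prop
    have := Measure.isProbabilityMeasure_map hmeas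
    refine eq_gaussianReal_of_mgf fun t => ?_
    rw [mgf_id_map hmeas, Real.coe_toNNReal _ (hC.inner_nonneg_left z), mgf]
    have := h (t • z)
    simp only [map_smul, real_inner_smul_left, real_inner_smul_right] at this
    rw [this]
    congr 1; ring
  have hg : IsGaussian ν := isGaussian_of_map_eq_gaussianReal fun L => by
    refine ⟨⟪(toDual ℝ X).symm L, m⟫,
      ⟪C ((toDual ℝ X).symm L), (toDual ℝ X).symm L⟫.toNNReal, ?_⟩
    rw [← hmap]
    congr 1
    ext a
    simp
  have h2 : MemLp id 2 ν := IsGaussian.memLp_two_id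
  have hmean : ∀ z : X, ∫ a, ⟪z, a⟫ ∂ν = ⟪z, m⟫ := fun z => by
    have := integral_id_gaussianReal (μ := ⟪z, m⟫) (v := ⟪C z, z⟫.toNNReal)
    rw [← hmap z, integral_map (by fun_prop) (by fun_prop)] at this
    exact this
  have hvar : ∀ z : X, covarianceBilin ν z z = ⟪C z, z⟫ := fun z => by
    rw [covarianceBilin_self h2]
    have := variance_id_gaussianReal (μ := ⟪z, m⟫) (v := ⟪C z, z⟫.toNNReal)
    rw [← hmap z, variance_map (by fun_prop) (by fun_prop)] at this
    rw [Real.coe_toNNReal _ (hC.inner_nonneg_left z)] at this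
    exact this
  refine ⟨hg, ext_inner_left ℝ fun z => ?_, fun x y => ?_⟩
  · exact (integral_inner (h2.integrable (by norm_num)) z).symm.trans (hmean z)
  -- Polarization recovers the covariance from the variances.
  · have hxy := hvar (x + y)
    simp only [map_add, add_apply, inner_add_left, inner_add_right] at hxy
    rw [hvar, hvar, covarianceBilin_comm y x, hC.inner_left_eq_inner_right y x,
      real_inner_comm (C x) y] at hxy
    linarith

lemma IsGaussianWith.unique {μ ν : Measure X} {m : X} {C : X →L[ℝ] X}
    (hμ : IsGaussianWith μ m C) (hν : IsGaussianWith ν m C) : μ = ν := by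
  have := hμ.1
  have := hν.1
  refine IsGaussian.ext (hμ.2.1.trans hν.2.1.symm) ?_
  ext x y
  rw [hμ.2.2, hν.2.2]

/-- The Cameron–Martin formula for shifts in the range of the covariance operator. -/
lemma IsGaussianWith.map_add_eq_tilted {μ : Measure X} {m : X} {C : X →L[ℝ] X}
    (h : IsGaussianWith μ m C) (hC : C.IsPositive) (x : X) :
    μ.map (fun a => a + C x) = μ.tilted fun a => ⟪x, a⟫ := by
  have := h.1
  have hmeas : Measurable fun a : X => a + C x := by fun_prop
  have := Measure.isProbabilityMeasure_map (μ := μ) hmeas.aemeasurable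
  have := isProbabilityMeasure_tilted (h.integrable_exp hC x)
  refine IsGaussianWith.unique (m := m + C x) (C := C)
    (isGaussianWith_of_integral_exp hC fun z => ?_) (isGaussianWith_of_integral_exp hC fun z => ?_)
  · rw [integral_map (by fun_prop) (by fun_prop)]
    simp only [inner_add_right, Real.exp_add, integral_mul_const, h.integral_exp hC]
    ring
  · rw [integral_exp_tilted]
    simp only [Pi.add_apply, ← inner_add_left, h.integral_exp hC]
    rw [← Real.exp_sub]
    congr 1
    simp only [map_add, inner_add_left, inner_add_right]
    rw [hC.inner_left_eq_inner_right z x, real_inner_comm z (C x)]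
    ring

lemma IsGaussianWith.integral_add {μ : Measure X} {m : X} {C : X →L[ℝ] X}
    (h : IsGaussianWith μ m C) (hC : C.IsPositive) (x : X) (f : X → ℝ) :
    ∫ a, f (a + C x) ∂μ
      = Real.exp (-(⟪x, m⟫ + ⟪C x, x⟫ / 2)) * ∫ a, Real.exp ⟪x, a⟫ * f a ∂μ := by
  have hm := (Homeomorph.addRight (C x)).measurableEmbedding.integral_map (μ := μ) f
  simp only [Homeomorph.coe_addRight] at hm
  rw [← hm, h.map_add_eq_tilted hC, integral_tilted, h.integral_exp hC, ← integral_const_mul]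
  refine integral_congr_ae (ae_of_all _ fun a => ?_)
  simp only [smul_eq_mul, Real.exp_neg]
  ring

/-- Tilting `N(m, C)` by a concave quadratic gives the Gaussian measure with precision operator
`B + C⁻¹`. -/
lemma IsGaussianWith.tilted_quadratic {μ : Measure X} {m : X} {B C G : X →L[ℝ] X}
    (h : IsGaussianWith μ m C) (hB : B.IsPositive) (hC : C.IsPositive) (hGpos : G.IsPositive)
    (hG : ∀ x, G x + C (B (G x)) = C x) (b : X) (c : ℝ) :
    IsGaussianWith (μ.tilted fun a => ⟪b, a⟫ - ⟪B a, a⟫ / 2 + c) (G b + (m - G (B m))) G := by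
  have := h.1
  set φ : X → ℝ := fun a => ⟪b, a⟫ - ⟪B a, a⟫ / 2 + c with hφ
  have hint : Integrable (fun a => Real.exp (φ a)) μ := by
    -- Since `B ≥ 0`, dropping the quadratic term gives an integrable majorant.
    refine ((h.integrable_exp hC b).mul_const (Real.exp c)).mono'
      (by fun_prop) (ae_of_all _ fun a => ?_)
    rw [Real.norm_of_nonneg (Real.exp_pos _).le, ← Real.exp_add]
    have := hB.inner_nonneg_left a
    gcongr
    simp only [hφ]
    linarith
  have := isProbabilityMeasure_tilted hint
  have hI0 : 0 < ∫ a, Real.exp (φ a) ∂μ := integral_exp_pos hint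
  refine isGaussianWith_of_integral_exp hGpos fun z => ?_
  rw [integral_exp_tilted]
  have hx : C (z - B (G z)) = G z := by rw [map_sub, ← hG z]; abel
  -- The shift is `C (z - B (G z)) = G z`. The factor `exp ⟪B (G z), a⟫` cancels the cross term of
  -- the shifted quadratic, leaving a constant times `exp (φ a)`; on the other side it completes the
  -- Cameron–Martin weight to `exp ⟪z, a⟫`.
  have key := h.integral_add hC (z - B (G z)) (fun a => Real.exp (⟪B (G z), a⟫ + φ a))
  rw [hx] at key
  have hl : ∀ a, Real.exp (⟪B (G z), a + G z⟫ + φ (a + G z))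
      = Real.exp (⟪b, G z⟫ + ⟪B (G z), G z⟫ / 2) * Real.exp (φ a) := fun a => by
    rw [← Real.exp_add]
    congr 1
    simp only [hφ, map_add, inner_add_left, inner_add_right]
    rw [hB.inner_left_eq_inner_right a (G z), real_inner_comm a (B (G z))]
    ring
  have hr : ∀ a, Real.exp ⟪z - B (G z), a⟫ * Real.exp (⟪B (G z), a⟫ + φ a)
      = Real.exp ((φ + fun a => ⟪z, a⟫) a) := fun a => by
    rw [← Real.exp_add]
    congr 1
    simp only [Pi.add_apply, inner_sub_left]
    ring
  simp only [hl, hr, integral_const_mul] at key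
  rw [div_eq_iff hI0.ne', ← mul_right_inj' (Real.exp_pos _).ne', ← key, ← mul_assoc,
    ← Real.exp_add]
  congr 2
  have h1 : ⟪z, G (B m)⟫ = ⟪B (G z), m⟫ := by
    rw [← hGpos.inner_left_eq_inner_right, ← hB.inner_left_eq_inner_right]
  have h2 : ⟪z, G b⟫ = ⟪b, G z⟫ := by
    rw [← hGpos.inner_left_eq_inner_right, real_inner_comm]
  simp only [inner_add_right, inner_sub_right, inner_sub_left, h1, h2]
  rw [real_inner_comm (G z) (B (G z))]
  ring

end Gaussian

/-! ### The white-noise likelihood as a quadratic -/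

section Likelihood

lemma ringInverse_smul_one {s : ℝ} (hs : s ≠ 0) :
    Ring.inverse (s • (1 : Y →L[ℝ] Y)) = s⁻¹ • (1 : Y →L[ℝ] Y) :=
  Ring.inverse_unit (⟨s • 1, s⁻¹ • 1, by simp [hs], by simp [hs]⟩ : (Y →L[ℝ] Y)ˣ)

lemma negLogLikelihood_white (W : X →L[ℝ] Y) {s : ℝ} (hs : s ≠ 0) (p : Y) (a : X) :
    negLogLikelihood (s • (1 : Y →L[ℝ] Y)) W p a = s⁻¹ * ‖W a - p‖ ^ 2 / 2 := by
  rw [negLogLikelihood, ringInverse_smul_one hs]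
  simp only [smul_apply, one_apply_eq_self, real_inner_smul_left,
    real_inner_self_eq_norm_sq]
  ring

lemma neg_negLogLikelihood_white [CompleteSpace X] [CompleteSpace Y] (W : X →L[ℝ] Y) {s : ℝ} (hs : s ≠ 0) (p : Y) (a : X) :
    -negLogLikelihood (s • (1 : Y →L[ℝ] Y)) W p a
      = ⟪s⁻¹ • W.adjoint p, a⟫ - ⟪(s⁻¹ • (W.adjoint ∘L W) : X →L[ℝ] X) a, a⟫ / 2
        + -(s⁻¹ * ‖p‖ ^ 2 / 2) := by
  rw [negLogLikelihood_white W hs, norm_sub_sq_real]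
  simp only [smul_apply, ContinuousLinearMap.comp_apply, real_inner_smul_left,
    ContinuousLinearMap.adjoint_inner_left, real_inner_self_eq_norm_sq]
  rw [real_inner_comm p (W a)]
  ring

end Likelihood

/-! ### Minimization of the Tikhonov functional -/

section MAP

/-- Completing the square in the Tikhonov functional. -/
lemma tikhonov_complete_square {B S : X →L[ℝ] X} (hB : B.IsPositive) (hS : S.IsPositive)
    (b a w : X) (c : ℝ) (q : X → ℝ) (hq : ∀ a, -q a = ⟪b, a⟫ - ⟪B a, a⟫ / 2 + c) :
    q (a + S w) + 1 / 2 * ‖S (b - B a) + w‖ ^ 2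
      = (q a + 1 / 2 * ‖S (b - B a)‖ ^ 2) + (⟪B (S w), S w⟫ / 2 + ‖w‖ ^ 2 / 2) := by
  have h1 := hq (a + S w)
  have h2 := hq a
  simp only [map_add, inner_add_left, inner_add_right] at h1
  rw [hB.inner_left_eq_inner_right (S w) a, real_inner_comm (B a) (S w)] at h1
  rw [norm_add_sq_real, hS.inner_left_eq_inner_right, inner_sub_left]
  linarith

/-- `haM` is the Euler–Lagrange equation with `C⁻¹` cleared. At `aM + S w`, with `S = posSqrt C`,
the functional exceeds its value at `aM` by at least `‖w‖² / 2`, whence existence and uniqueness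
together. -/
lemma isMAP_iff {Γn : Y →L[ℝ] Y} {W : X →L[ℝ] Y} {p : Y} {B C : X →L[ℝ] X}
    (hC : IsPositiveDefinite C) (hsqrt : ∃ S : X →L[ℝ] X, S.IsPositive ∧ S ∘L S = C)
    (hB : B.IsPositive) {b : X} {c : ℝ}
    (hq : ∀ a, -negLogLikelihood Γn W p a = ⟪b, a⟫ - ⟪B a, a⟫ / 2 + c) {a₀ aM : X}
    (haM : aM = a₀ + C (b - B aM)) (a : X) : IsMAP Γn W p a₀ C a ↔ a = aM := by
  obtain ⟨hS, hSC⟩ := posSqrt_spec hsqrt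
  have hCx : ∀ x, C x = posSqrt C (posSqrt C x) := fun x => by
    conv_lhs => rw [← hSC]
    rfl
  have hSinj : Function.Injective (posSqrt C) := fun x y hxy =>
    hC.injective (by rw [hCx, hCx, hxy])
  have hval : ∀ w, tikhonov Γn W p a₀ C (aM + posSqrt C w)
      = (((negLogLikelihood Γn W p aM + 1 / 2 * ‖posSqrt C (b - B aM)‖ ^ 2)
        + (⟪B (posSqrt C w), posSqrt C w⟫ / 2 + ‖w‖ ^ 2 / 2) : ℝ) : EReal) := by
    intro w
    have he : aM + posSqrt C w - a₀ = posSqrt C (posSqrt C (b - B aM) + w) := by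
      rw [map_add, ← hCx]
      nth_rewrite 1 [haM]
      abel
    have hmem : aM + posSqrt C w - a₀ ∈ (opInv (posSqrt C)).domain :=
      mem_opInv_domain.2 ⟨_, he.symm⟩
    have hv : opInv (posSqrt C) ⟨aM + posSqrt C w - a₀, hmem⟩
        = posSqrt C (b - B aM) + w := by
      simp only [he]
      exact opInv_apply hSinj _ _
    rw [tikhonov, dif_pos hmem, hv, tikhonov_complete_square hB hS b aM w c _ hq]
  have hval0 : tikhonov Γn W p a₀ C aM
      = ((negLogLikelihood Γn W p aM + 1 / 2 * ‖posSqrt C (b - B aM)‖ ^ 2 : ℝ) : EReal) := by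
    simpa using hval 0
  -- `aM - a₀` lies in the range of `C`, hence of its square root, so recentring at `aM` keeps the
  -- domain of finiteness.
  have hdom : ∀ a', a' - a₀ ∈ (opInv (posSqrt C)).domain → ∃ w, a' = aM + posSqrt C w := by
    intro a' h
    obtain ⟨v, hv⟩ := mem_opInv_domain.1 h
    refine ⟨v - posSqrt C (b - B aM), ?_⟩
    rw [map_sub, ← hCx, hv]
    nth_rewrite 1 [haM]
    abel
  constructor
  · intro h
    have hle := h aM
    have hmem : a - a₀ ∈ (opInv (posSqrt C)).domain := by
      by_contra hn
      rw [tikhonov, dif_neg hn, hval0] at hle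
      exact EReal.coe_ne_top _ (top_le_iff.1 hle)
    obtain ⟨w, rfl⟩ := hdom a hmem
    rw [hval, hval0, EReal.coe_le_coe_iff] at hle
    have hb := hB.inner_nonneg_left (posSqrt C w)
    have hw : ‖w‖ ^ 2 = 0 := le_antisymm (by linarith) (sq_nonneg _)
    rw [norm_eq_zero.1 (pow_eq_zero_iff (two_ne_zero) |>.1 hw), map_zero, add_zero]
  · rintro rfl a'
    by_cases hmem : a' - a₀ ∈ (opInv (posSqrt C)).domain
    · obtain ⟨w, rfl⟩ := hdom a' hmem
      rw [hval, hval0, EReal.coe_le_coe_iff]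
      have hb := hB.inner_nonneg_left (posSqrt C w)
      have := sq_nonneg ‖w‖
      linarith
    · conv_rhs => rw [tikhonov, dif_neg hmem]
      exact le_top

end MAP

end BayesInverse

end

/-! ### Assembly -/

theorem proposition3p6 {X Y : Type*}
    [NormedAddCommGroup X] [InnerProductSpace ℝ X] [CompleteSpace X]
    [TopologicalSpace.SeparableSpace X] [MeasurableSpace X] [BorelSpace X]
    [NormedAddCommGroup Y] [InnerProductSpace ℝ Y] [CompleteSpace Y]
    (W : X →L[ℝ] Y) (σ : ℝ) (hσ : 0 < σ)
    (Γpr : X →L[ℝ] X) (hpos : BayesInverse.IsPositiveDefinite Γpr)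
    (htr : BayesInverse.IsTraceClass Γpr) :
    ∃ Γpost : X →L[ℝ] X,
      -- `σ⁻² W* W + Γpr⁻¹`, with domain the range of `Γpr`, is injective and its inverse is the
      -- everywhere defined bounded operator `Γpost`
      (Function.Injective
          ((((σ ^ 2)⁻¹ • (W.adjoint ∘L W) : X →L[ℝ] X) : X →ₗ[ℝ] X).toPMap ⊤
            + BayesInverse.opInv Γpr) ∧
        ((((σ ^ 2)⁻¹ • (W.adjoint ∘L W) : X →L[ℝ] X) : X →ₗ[ℝ] X).toPMap ⊤
            + BayesInverse.opInv Γpr).inverse = (Γpost : X →ₗ[ℝ] X).toPMap ⊤) ∧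
      BayesInverse.IsPositiveDefinite Γpost ∧
      BayesInverse.IsTraceClass Γpost ∧
      (∀ (s : Set X) (e : HilbertBasis s ℝ X),
        BayesInverse.traceAlong e Γpost ≤ BayesInverse.traceAlong e Γpr) ∧
      -- `T` is the bounded extension to all of `X` of `Γpost Γpr⁻¹`
      ∃ T : X →L[ℝ] X,
        (∀ v : (BayesInverse.opInv Γpr).domain,
          T (v : X) = Γpost (BayesInverse.opInv Γpr v)) ∧
        ∀ (a₀ : X) (pobs : Y), ∃ aMAP : X,
          aMAP = Γpost ((σ ^ 2)⁻¹ • W.adjoint pobs) + T a₀ ∧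
          (∀ h : a₀ ∈ (BayesInverse.opInv Γpr).domain,
            aMAP = Γpost ((σ ^ 2)⁻¹ • W.adjoint pobs + BayesInverse.opInv Γpr ⟨a₀, h⟩)) ∧
          (∀ a : X, BayesInverse.IsMAP (σ ^ 2 • (1 : Y →L[ℝ] Y)) W pobs a₀ Γpr a ↔ a = aMAP) ∧
          ∀ μpr : MeasureTheory.Measure X, BayesInverse.IsGaussianWith μpr a₀ Γpr →
            BayesInverse.IsGaussianWith
              (BayesInverse.posterior (σ ^ 2 • (1 : Y →L[ℝ] Y)) W pobs μpr) aMAP Γpost := by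
  have hs : σ ^ 2 ≠ 0 := (pow_pos hσ 2).ne'
  have : SecondCountableTopology X := UniformSpace.secondCountable_of_separable X
  have hsqrt := BayesInverse.exists_posSqrt htr.1 hpos.1
  obtain ⟨S, hS, hSC⟩ := hsqrt
  set B : X →L[ℝ] X := (σ ^ 2)⁻¹ • (W.adjoint ∘L W) with hBdef
  have hB : B.IsPositive :=
    W.isPositive_adjoint_comp_self.smul_of_nonneg (inv_nonneg.2 (sq_nonneg σ))
  obtain ⟨G, hsym, hG, hG'⟩ := BayesInverse.exists_update hB hS hSC
  have hGpd := BayesInverse.isPositiveDefinite_update hB hpos hsym hG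
  -- At `v = Γpr x`, `G x + G (B v) = v` reads `G Γpr⁻¹ v = v - G (B v)`, whose right side is
  -- bounded on all of `X`.
  have hT : ∀ v : (BayesInverse.opInv Γpr).domain,
      (v : X) - G (B v) = G (BayesInverse.opInv Γpr v) := by
    rintro ⟨v, hv⟩
    obtain ⟨x, rfl⟩ := BayesInverse.mem_opInv_domain.1 hv
    rw [BayesInverse.opInv_apply hpos.injective]
    exact sub_eq_of_eq_add (hG' x).symm
  refine ⟨G, ⟨BayesInverse.add_opInv_injective hpos.injective hG',
    BayesInverse.inverse_add_opInv hpos.injective hG hG'⟩, hGpd,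
    BayesInverse.isTraceClass_update hB hpos.1 htr hGpd.1 hG,
    BayesInverse.traceAlong_update_le hB hpos.1 htr hGpd.1 hG,
    1 - G ∘L B, hT, fun a₀ pobs => ⟨_, rfl, fun h => ?_, ?_, fun μpr hμ => ?_⟩⟩
  · rw [map_add, ← hT ⟨a₀, h⟩]; rfl
  · refine BayesInverse.isMAP_iff hpos ⟨S, hS, hSC⟩ hB
      (BayesInverse.neg_negLogLikelihood_white W hs pobs) ?_
    set b := (σ ^ 2)⁻¹ • W.adjoint pobs
    change G b + (a₀ - G (B a₀)) = a₀ + Γpr (b - B (G b + (a₀ - G (B a₀))))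
    simp only [map_sub, map_add]
    rw [← hG b, ← hG (B a₀)]
    abel
  · rw [BayesInverse.posterior]
    simp only [BayesInverse.neg_negLogLikelihood_white W hs pobs]
    exact hμ.tilted_quadratic hB hpos.1 hGpd.1 hG _ _
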